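/- Let $L>2$. Rods of length $2$ arrive one after another at the interval $[0,L]$. The left endpoints of the arriving rods are independent and uniformly distributed on $[0,L-2]$; an arriving rod is placed if it does not overlap any rod placed earlier, and is discarded otherwise. The saturated configuration is the set of all rods that are ever placed. A gap is a maximal nonempty open subinterval of $[0,L]$ disjoint from all placed rods (so the pieces next to the two ends of $[0,L]$ count as gaps), and its size is its length. "With high probability" means with probability tending to $1$ as $L\to\infty$. (i) For every function $\eta$ with $\eta(L)=o(1/L)$ as $L\to\infty$, with high probability the saturated configuration on $[0,L]$ has no gap of size at least $2-\eta(L)$. (ii) For every $a>0$ there are $\delta>0$ and $L_0$ such that for all $L\ge L_0$, with probability at least $\delta$, the saturated configuration on $[0,L]$ has a gap of size at least $2-a/L$ between two adjacent rods. (iii) For every $\varepsilon>0$, with high probability the saturated configuration on $[0,L]$ has a gap of size at least $2-1/L^{1-\varepsilon}$ between two adjacent rods. -/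

import Mathlib

open Filter Topology MeasureTheory Asymptotics

namespace Parking

/-- Sample space: one number in `[0, 1]` for each arrival time `t = 0, 1, 2, …`. -/
abbrev Arrivals : Type := ℕ → unitInterval

/-- The arrivals are independent and uniformly distributed on `[0, 1]`. -/
noncomputable def arrivalLaw : Measure Arrivals :=
  Measure.infinitePi fun _ : ℕ => (volume : Measure unitInterval)

/-- Left endpoint of the candidate rod `[x, x + 2]` arriving at time `t`; for `L > 2` it is uniformly
distributed on `[0, L - 2]`, the set of positions at which a rod of length `2` lies in `[0, L]`. -/
noncomputable def candidate (L : ℝ) (ω : Arrivals) (t : ℕ) : ℝ := (L - 2) * (ω t : ℝ)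

/-- Left endpoints of the rods placed by the arrivals at the times `0, …, t - 1`: an arriving
candidate is placed exactly when it does not overlap any rod that was placed before. -/
def placed (L : ℝ) (ω : Arrivals) : ℕ → Set ℝ
  | 0 => ∅
  | t + 1 => placed L ω t ∪ {x | x = candidate L ω t ∧ ∀ y ∈ placed L ω t, 2 ≤ |x - y|}

/-- The saturated configuration: left endpoints of all rods in the infinite time limit. -/
def saturated (L : ℝ) (ω : Arrivals) : Set ℝ := ⋃ t, placed L ω t

/-- `(u, v)` is a gap of the configuration of the rods `[x, x + 2]`, `x ∈ S`, in `[0, L]`: it meets no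
rod, and each of its ends is an end of a rod or of the interval `[0, L]`. -/
def IsGap (L : ℝ) (S : Set ℝ) (u v : ℝ) : Prop :=
  u < v ∧ (u = 0 ∨ u - 2 ∈ S) ∧ (v = L ∨ v ∈ S) ∧ ∀ x ∈ S, x + 2 ≤ u ∨ v ≤ x

/-- `(u, v)` is a gap between two adjacent rods: the right end of one rod is `u`, the left end of
another one is `v`, and `(u, v)` meets no rod. -/
def IsInnerGap (S : Set ℝ) (u v : ℝ) : Prop :=
  u < v ∧ u - 2 ∈ S ∧ v ∈ S ∧ ∀ x ∈ S, x + 2 ≤ u ∨ v ≤ x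

/-- The saturated configuration on `[0, L]` has a gap of length at least `r`, where the pieces next
to the ends of `[0, L]` count as gaps. -/
def gapEvent (L r : ℝ) : Set Arrivals :=
  {ω | ∃ u v : ℝ, IsGap L (saturated L ω) u v ∧ r ≤ v - u}

/-- The saturated configuration on `[0, L]` has a gap of length at least `r` between two adjacent
rods. -/
def innerGapEvent (L r : ℝ) : Set Arrivals :=
  {ω | ∃ u v : ℝ, IsInnerGap (saturated L ω) u v ∧ r ≤ v - u}

/-- The events `E L` hold with high probability as `L → ∞`. -/
def WithHighProbability (E : ℝ → Set Arrivals) : Prop :=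
  Tendsto (fun L => arrivalLaw (E L)) atTop (𝓝 1)

end Parking

namespace Parking

open ProbabilityTheory Set

instance : IsProbabilityMeasure arrivalLaw := by
  unfold arrivalLaw; infer_instance

lemma iIndepFun_arrivals : iIndepFun (fun (t : ℕ) (ω : Arrivals) => ω t) arrivalLaw := by
  unfold arrivalLaw
  exact iIndepFun_infinitePi (P := fun _ : ℕ => (volume : Measure unitInterval))
    (X := fun _ x => x) (fun _ => measurable_id)

lemma map_arrival (t : ℕ) :
    arrivalLaw.map (fun ω : Arrivals => ω t) = (volume : Measure unitInterval) := by
  unfold arrivalLaw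
  exact (measurePreserving_eval_infinitePi (fun _ : ℕ => (volume : Measure unitInterval)) t).map_eq

/-- A function of the arrivals at the times in `F` is independent of the arrival at a time outside
of `F`. -/
lemma map_prodMk_arrival {S : Type*} [MeasurableSpace S] {G : Arrivals → S} (hG : Measurable G)
    (F : Finset ℕ) (hGF : ∀ ω ω' : Arrivals, (∀ r ∈ F, ω r = ω' r) → G ω = G ω') {t : ℕ}
    (ht : t ∉ F) :
    arrivalLaw.map (fun ω => (G ω, ω t)) = (arrivalLaw.map G).prod volume := by
  classical
  have hind := iIndepFun_arrivals.indepFun_finset F {t} (by simpa using ht)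
    (fun i => measurable_pi_apply i)
  let ext : (F → unitInterval) → Arrivals := fun g r => if h : r ∈ F then g ⟨r, h⟩ else 0
  have hext : Measurable ext := by
    refine measurable_pi_iff.2 fun r => ?_
    by_cases h : r ∈ F
    · simpa [ext, h] using measurable_pi_apply _
    · simp [ext, h]
  have hind' : IndepFun G (fun ω : Arrivals => ω t) arrivalLaw := by
    have h := hind.comp (hG.comp hext)
      (measurable_pi_apply (⟨t, by simp⟩ : ({t} : Finset ℕ)))
    have e : (G ∘ ext) ∘ (fun (ω : Arrivals) (i : F) => ω i) = G := by
      funext ω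
      exact hGF _ _ fun r hr => by simp [ext, hr]
    rw [e] at h
    exact h
  rw [(indepFun_iff_map_prod_eq_prod_map_map hG.aemeasurable
    (measurable_pi_apply t).aemeasurable).1 hind', map_arrival]

lemma arrivalLaw_rect_le {s : ℕ} {F : Finset ℕ} (hs : s ∉ F)
    {B : ℕ → Set (unitInterval × unitInterval)} (hB : ∀ r, MeasurableSet (B r)) {C : ENNReal}
    (hC : ∀ x : unitInterval, ∏ r ∈ F, volume (Prod.mk x ⁻¹' B r) ≤ C) :
    arrivalLaw {ω | ∀ r ∈ F, (ω s, ω r) ∈ B r} ≤ C := by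
  let D : Set (Arrivals × unitInterval) := {p | ∀ r ∈ F, (p.2, p.1 r) ∈ B r}
  let G : Arrivals → Arrivals := fun ω r => if r ∈ F then ω r else 0
  have hG : Measurable G := by
    refine measurable_pi_iff.2 fun r => ?_
    by_cases h : r ∈ F
    · simpa [G, h] using measurable_pi_apply _
    · simp [G, h]
  have hD : MeasurableSet D := by
    have : D = ⋂ r ∈ F, (fun p : Arrivals × unitInterval => (p.2, p.1 r)) ⁻¹' B r := by
      ext p; simp [D]
    rw [this]
    exact F.measurableSet_biInter fun r _ => (by fun_prop : Measurable _) (hB r)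
  have h1 : {ω : Arrivals | ∀ r ∈ F, (ω s, ω r) ∈ B r} = (fun ω => (G ω, ω s)) ⁻¹' D := by
    ext ω
    simp +contextual [D, G]
  rw [h1, ← Measure.map_apply (hG.prodMk (measurable_pi_apply s)) hD,
    map_prodMk_arrival hG F (fun ω ω' h => by
      funext r
      by_cases hr : r ∈ F
      · simp [G, hr, h r hr]
      · simp [G, hr]) hs,
    Measure.prod_apply_symm hD]
  calc ∫⁻ x, (arrivalLaw.map G) ((fun g => (g, x)) ⁻¹' D)
      ≤ ∫⁻ _ : unitInterval, C := by
        refine lintegral_mono fun x => ?_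
        rw [Measure.map_apply hG (measurable_prodMk_right hD)]
        have h2 : G ⁻¹' ((fun g => (g, x)) ⁻¹' D) = Set.pi F fun r => Prod.mk x ⁻¹' B r := by
          ext ω
          simp +contextual [D, G, Set.mem_pi]
        rw [h2]
        unfold arrivalLaw
        rw [Measure.infinitePi_pi _ fun r _ => measurable_prodMk_left (hB r)]
        exact hC x
    _ = C := by simp

/-- The probability that a candidate lies in `B`. -/
lemma volume_candidate {ℓ : ℝ} (hℓ : 0 < ℓ) {B : Set ℝ} (hB : MeasurableSet B) :
    (volume : Measure unitInterval) {x | ℓ * (x : ℝ) ∈ B}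
      = ENNReal.ofReal ℓ⁻¹ * volume (B ∩ Icc 0 ℓ) := by
  have hm : MeasurableSet ((fun y : ℝ => ℓ * y) ⁻¹' B) := (measurable_const_mul ℓ) hB
  have h := unitInterval.measurePreserving_coe.measure_preimage hm.nullMeasurableSet
  rw [Measure.restrict_apply hm] at h
  have e : (fun y : ℝ => ℓ * y) ⁻¹' B ∩ unitInterval = (fun y : ℝ => ℓ * y) ⁻¹' (B ∩ Icc 0 ℓ) := by
    ext y
    simp only [mem_inter_iff, mem_preimage, unitInterval, mem_Icc]
    refine and_congr_right fun _ => and_congr ?_ ?_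
    · exact ⟨fun h => by positivity, fun h => nonneg_of_mul_nonneg_right h hℓ⟩
    · exact ⟨fun h => by nlinarith, fun h => by nlinarith⟩
  rw [e, Real.volume_preimage_mul_left hℓ.ne', abs_of_pos (inv_pos.2 hℓ)] at h
  exact h

lemma volume_candidate_le {ℓ : ℝ} (hℓ : 0 < ℓ) {B : Set ℝ} (hB : MeasurableSet B) :
    (volume : Measure unitInterval) {x | ℓ * (x : ℝ) ∈ B} ≤ ENNReal.ofReal ℓ⁻¹ * volume B := by
  rw [volume_candidate hℓ hB]
  gcongr
  exact inter_subset_left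

lemma volume_candidate_of_subset {ℓ : ℝ} (hℓ : 0 < ℓ) {B : Set ℝ} (hB : MeasurableSet B)
    (hBℓ : B ⊆ Icc 0 ℓ) :
    (volume : Measure unitInterval) {x | ℓ * (x : ℝ) ∈ B} = ENNReal.ofReal ℓ⁻¹ * volume B := by
  rw [volume_candidate hℓ hB, inter_eq_left.2 hBℓ]

/-- Almost surely infinitely many arrivals fall in a set of positive measure. -/
lemma ae_frequently_arrival {B : Set unitInterval} (hB : MeasurableSet B) (h0 : volume B ≠ 0) :
    ∀ᵐ ω ∂arrivalLaw, ∃ᶠ t in atTop, ω t ∈ B := by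
  have key : ∀ n : ℕ, arrivalLaw {ω | ∀ t, n ≤ t → ω t ∉ B} = 0 := by
    intro n
    have hq : volume Bᶜ < 1 := by
      rw [prob_compl_eq_one_sub hB]
      exact ENNReal.sub_lt_self (by simp) (by simp) h0
    refine le_antisymm (ge_of_tendsto' (ENNReal.tendsto_pow_atTop_nhds_zero_of_lt_one hq)
      fun m => ?_) zero_le
    calc arrivalLaw {ω | ∀ t, n ≤ t → ω t ∉ B}
        ≤ arrivalLaw (Set.pi (Finset.Ico n (n + m)) fun _ => Bᶜ) :=
          measure_mono fun ω h t ht => h t (Finset.mem_Ico.1 ht).1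
      _ = (volume Bᶜ) ^ m := by
          unfold arrivalLaw
          rw [Measure.infinitePi_pi _ fun r _ => hB.compl]
          simp
  have := ae_all_iff.2 fun n => (measure_eq_zero_iff_ae_notMem.1 (key n))
  filter_upwards [this] with ω h
  rw [frequently_atTop]
  intro n
  have := h n
  simp only [not_forall, not_not] at this
  obtain ⟨t, ht, h⟩ := this
  exact ⟨t, ht, h⟩

lemma ae_frequently_candidate {L : ℝ} {B : Set ℝ} (hL : 2 < L)
    (hB : MeasurableSet B) (hBL : B ⊆ Icc 0 (L - 2)) (h0 : volume B ≠ 0) :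
    ∀ᵐ ω ∂arrivalLaw, ∃ᶠ t in atTop, candidate L ω t ∈ B := by
  have hℓ : 0 < L - 2 := by linarith
  refine ae_frequently_arrival (B := {x : unitInterval | (L - 2) * (x : ℝ) ∈ B})
    ((by fun_prop : Measurable fun x : unitInterval => (L - 2) * (x : ℝ)) hB) ?_
  rw [volume_candidate_of_subset hℓ hB hBL]
  simp [h0, hℓ]

/-- If a nonnegative function of the current state does not increase on average at any step of a
Markov chain driven by the arrivals, then its mean stays below its initial value. -/
lemma lintegral_chain_le {S : Type*} [MeasurableSpace S] {step : S → unitInterval → S}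
    (hstep : Measurable (Function.uncurry step)) {φ : S → ENNReal} (hφ : Measurable φ)
    (hdec : ∀ s, ∫⁻ x, φ (step s x) ≤ φ s) {state : ℕ → Arrivals → S} {s₀ : S}
    (h0 : ∀ ω, state 0 ω = s₀) (hsucc : ∀ t ω, state (t + 1) ω = step (state t ω) (ω t)) (t : ℕ) :
    Measurable (state t) ∧ ∫⁻ ω, φ (state t ω) ∂arrivalLaw ≤ φ s₀ := by
  have hm : ∀ t, Measurable (state t) := by
    intro t
    induction t with
    | zero => rw [show state 0 = fun _ => s₀ from funext h0]; exact measurable_const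
    | succ t ih =>
      rw [show state (t + 1) = fun ω => Function.uncurry step (state t ω, ω t) from
        funext (hsucc t)]
      exact hstep.comp (ih.prodMk (measurable_pi_apply t))
  have hdep : ∀ t, ∀ ω ω' : Arrivals, (∀ r ∈ Finset.range t, ω r = ω' r) →
      state t ω = state t ω' := by
    intro t
    induction t with
    | zero => intro ω ω' _; rw [h0, h0]
    | succ t ih =>
      intro ω ω' h
      rw [hsucc, hsucc, ih ω ω' fun r hr => h r (by simp at hr ⊢; omega), h t (by simp)]
  refine ⟨hm t, ?_⟩
  induction t with
  | zero => simp [h0]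
  | succ t ih =>
    refine le_trans ?_ ih
    have hf : Measurable fun p : S × unitInterval => φ (step p.1 p.2) := hφ.comp hstep
    calc ∫⁻ ω, φ (state (t + 1) ω) ∂arrivalLaw
        = ∫⁻ p, φ (step p.1 p.2) ∂(arrivalLaw.map fun ω => (state t ω, ω t)) := by
          rw [lintegral_map hf ((hm t).prodMk (measurable_pi_apply t))]
          simp [hsucc]
      _ = ∫⁻ ω, (∫⁻ x, φ (step (state t ω) x)) ∂arrivalLaw := by
          rw [map_prodMk_arrival (hm t) (Finset.range t) (hdep t) (by simp),
            lintegral_prod _ hf.aemeasurable, lintegral_map hf.lintegral_prod_right' (hm t)]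
      _ ≤ _ := lintegral_mono fun ω => hdec _

lemma candidate_mem {L : ℝ} (hL : 2 < L) (ω : Arrivals) (t : ℕ) :
    candidate L ω t ∈ Icc 0 (L - 2) := by
  have h0 := (ω t).2.1
  have h1 := (ω t).2.2
  unfold candidate
  constructor
  · nlinarith
  · nlinarith

lemma placed_mono (L : ℝ) (ω : Arrivals) : Monotone (placed L ω) :=
  monotone_nat_of_le_succ fun _ => subset_union_left

lemma placed_subset_saturated (L : ℝ) (ω : Arrivals) (t : ℕ) : placed L ω t ⊆ saturated L ω :=
  subset_iUnion _ t

lemma candidate_mem_placed {L : ℝ} {ω : Arrivals} {t : ℕ}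
    (h : ∀ y ∈ placed L ω t, 2 ≤ |candidate L ω t - y|) :
    candidate L ω t ∈ placed L ω (t + 1) :=
  Or.inr ⟨rfl, h⟩

lemma exists_time_of_mem_placed {L : ℝ} {ω : Arrivals} {n : ℕ} {x : ℝ} (hx : x ∈ placed L ω n) :
    ∃ t < n, x = candidate L ω t ∧ ∀ y ∈ placed L ω t, 2 ≤ |x - y| := by
  induction n with
  | zero => exact absurd hx (notMem_empty x)
  | succ n ih =>
    rcases hx with hx | ⟨hx, h⟩
    · obtain ⟨t, ht, h⟩ := ih hx
      exact ⟨t, by omega, h⟩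
    · exact ⟨n, by omega, hx, h⟩

lemma exists_time_of_mem_saturated {L : ℝ} {ω : Arrivals} {x : ℝ} (hx : x ∈ saturated L ω) :
    ∃ t, x = candidate L ω t ∧ (∀ y ∈ placed L ω t, 2 ≤ |x - y|) ∧ x ∈ placed L ω (t + 1) := by
  obtain ⟨n, hn⟩ := mem_iUnion.1 hx
  obtain ⟨t, -, rfl, h⟩ := exists_time_of_mem_placed hn
  exact ⟨t, rfl, h, candidate_mem_placed h⟩

lemma saturated_subset {L : ℝ} (hL : 2 < L) (ω : Arrivals) : saturated L ω ⊆ Icc 0 (L - 2) := by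
  intro x hx
  obtain ⟨t, rfl, -⟩ := exists_time_of_mem_saturated hx
  exact candidate_mem hL ω t

lemma two_le_abs_sub {L : ℝ} {ω : Arrivals} {x y : ℝ} (hx : x ∈ saturated L ω)
    (hy : y ∈ saturated L ω) (hxy : x ≠ y) : 2 ≤ |x - y| := by
  obtain ⟨s, hs, hs', hs''⟩ := exists_time_of_mem_saturated hx
  obtain ⟨t, ht, ht', ht''⟩ := exists_time_of_mem_saturated hy
  rcases lt_trichotomy s t with h | h | h
  · rw [abs_sub_comm]
    exact ht' x (placed_mono L ω (by omega : s + 1 ≤ t) hs'')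
  · exact absurd (by rw [hs, ht, h]) hxy
  · exact hs' y (placed_mono L ω (by omega : t + 1 ≤ s) ht'')

section Gaps

variable {L : ℝ} {ω : Arrivals} {u v : ℝ}

/-- Before the rod at the right end of a long gap arrives, there are no arrivals at the left end of
the gap. -/
lemma candidate_notMem_of_right (hgap : ∀ x ∈ saturated L ω, x + 2 ≤ u ∨ v ≤ x)
    (huv : 3 / 2 ≤ v - u) {t : ℕ} (ht : ∀ x ∈ placed L ω t, 2 ≤ |v - x|) {r : ℕ} (hr : r < t) :
    candidate L ω r ∉ Icc u (u + 1) := by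
  rintro ⟨h1, h2⟩
  have hz : candidate L ω r ∈ saturated L ω := by
    refine placed_subset_saturated L ω (r + 1) (candidate_mem_placed fun x hx => ?_)
    rcases hgap x (placed_subset_saturated L ω r hx) with h | h
    · exact le_abs.2 (Or.inl (by linarith))
    · have := ht x (placed_mono L ω hr.le hx)
      rw [abs_of_nonpos (by linarith)] at this
      exact le_abs.2 (Or.inr (by linarith))
  rcases hgap _ hz with h | h <;> linarith

/-- Before the rod at the left end of a long gap arrives, there are no arrivals at the right end of
the gap. -/
lemma candidate_notMem_of_left (hgap : ∀ x ∈ saturated L ω, x + 2 ≤ u ∨ v ≤ x)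
    (huv : 3 / 2 ≤ v - u) {t : ℕ} (ht : ∀ x ∈ placed L ω t, 2 ≤ |u - 2 - x|) {r : ℕ}
    (hr : r < t) : candidate L ω r ∉ Icc (v - 3) (v - 2) := by
  rintro ⟨h1, h2⟩
  have hz : candidate L ω r ∈ saturated L ω := by
    refine placed_subset_saturated L ω (r + 1) (candidate_mem_placed fun x hx => ?_)
    rcases hgap x (placed_subset_saturated L ω r hx) with h | h
    · have := ht x (placed_mono L ω hr.le hx)
      rw [abs_of_nonneg (by linarith)] at this
      exact le_abs.2 (Or.inl (by linarith))
    · exact le_abs.2 (Or.inr (by linarith))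
  rcases hgap _ hz with h | h <;> linarith

lemma gap_le_two (hL : 2 < L) (h : IsGap L (saturated L ω) u v)
    (hω : ∀ p q : ℚ, p < q → Ioo (p : ℝ) q ⊆ Icc 0 (L - 2) → ∃ t, candidate L ω t ∈ Ioo (p : ℝ) q) :
    v - u ≤ 2 := by
  obtain ⟨huv, hu, hv, hgap⟩ := h
  by_contra! hlt
  obtain ⟨p, hp, hp'⟩ := exists_rat_btwn (show u < v - 2 by linarith)
  obtain ⟨q, hq, hq'⟩ := exists_rat_btwn hp'
  have hu0 : 0 ≤ u := by
    rcases hu with h | h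
    · exact h.ge
    · linarith [(saturated_subset hL ω h).1]
  have hvL : v ≤ L := by
    rcases hv with h | h
    · exact h.le
    · linarith [(saturated_subset hL ω h).2]
  obtain ⟨t, h1, h2⟩ := hω p q (by exact_mod_cast hq) fun x hx =>
    ⟨by linarith [hx.1], by linarith [hx.2]⟩
  have hz : candidate L ω t ∈ saturated L ω := by
    refine placed_subset_saturated L ω (t + 1) (candidate_mem_placed fun x hx => ?_)
    rcases hgap x (placed_subset_saturated L ω t hx) with h | h
    · exact le_abs.2 (Or.inl (by linarith))
    · exact le_abs.2 (Or.inr (by linarith))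
  rcases hgap _ hz with h | h <;> linarith

end Gaps

/-- The positions whose signed distance from `a` in direction `e` lies in `[c, d]`. -/
def offset (e a c d : ℝ) : Set ℝ := {y | e * (y - a) ∈ Icc c d}

lemma measurableSet_offset (e a c d : ℝ) : MeasurableSet (offset e a c d) :=
  (by fun_prop : Measurable fun y : ℝ => e * (y - a)) measurableSet_Icc

lemma offset_one (a c d : ℝ) : offset 1 a c d = Icc (a + c) (a + d) := by
  ext y
  simp only [offset, mem_Icc, one_mul]
  exact and_congr ⟨fun h => by linarith, fun h => by linarith⟩
    ⟨fun h => by linarith, fun h => by linarith⟩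

lemma offset_neg_one (a c d : ℝ) : offset (-1) a c d = Icc (a - d) (a - c) := by
  ext y
  simp only [offset, mem_Icc]
  constructor <;> rintro ⟨h1, h2⟩ <;> constructor <;> linarith

lemma volume_offset {e : ℝ} (he : e = 1 ∨ e = -1) (a c d : ℝ) :
    volume (offset e a c d) = ENNReal.ofReal (d - c) := by
  rcases he with rfl | rfl
  · rw [offset_one, Real.volume_Icc]; congr 1; ring
  · rw [offset_neg_one, Real.volume_Icc]; congr 1; ring

/-- The arrival at time `t` closes a gap of length in `[2 - η, 2]` next to a rod or wall at `a`,
while the times in `F` brought no arrival next to `a`. -/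
lemma volume_closing_le {ℓ η e a : ℝ} (hℓ : 0 < ℓ) (hη : η ≤ 1 / 2)
    (he : e = 1 ∨ e = -1) (ha : a ∈ Icc (-2) (ℓ + 2)) (n : ℕ) :
    (volume : Measure unitInterval) {x | ℓ * (x : ℝ) ∈ offset e a (4 - η) 4} *
      (volume : Measure unitInterval) {x | ℓ * (x : ℝ) ∈ (offset e a 2 3)ᶜ} ^ n ≤
    ENNReal.ofReal ℓ⁻¹ * ENNReal.ofReal η * (1 - ENNReal.ofReal ℓ⁻¹) ^ n := by
  by_cases hx : ∃ y ∈ Icc 0 ℓ, y ∈ offset e a (4 - η) 4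
  · obtain ⟨y, hy, hya⟩ := hx
    have hsub : offset e a 2 3 ⊆ Icc 0 ℓ := by
      rcases he with rfl | rfl
      · rw [offset_one] at hya ⊢
        exact Icc_subset_Icc (by linarith [ha.1]) (by linarith [hya.1, hy.2])
      · rw [offset_neg_one] at hya ⊢
        exact Icc_subset_Icc (by linarith [hya.2, hy.1]) (by linarith [ha.2])
    gcongr
    · refine (volume_candidate_le hℓ (measurableSet_offset _ _ _ _)).trans_eq ?_
      rw [volume_offset he]
      congr 2; ring
    · have h := volume_candidate_of_subset hℓ (measurableSet_offset e a 2 3) hsub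
      rw [volume_offset he] at h
      have hm : MeasurableSet {x : unitInterval | ℓ * (x : ℝ) ∈ offset e a 2 3} :=
        (by fun_prop : Measurable fun x : unitInterval => ℓ * (x : ℝ))
          (measurableSet_offset e a 2 3)
      have hc := prob_compl_eq_one_sub (μ := (volume : Measure unitInterval)) hm
      rw [h] at hc
      refine (le_of_eq hc).trans_eq ?_
      norm_num
  · have : {x : unitInterval | ℓ * (x : ℝ) ∈ offset e a (4 - η) 4} = ∅ := by
      ext x
      simp only [mem_empty_iff_false, iff_false]
      intro h
      have h0 := x.2.1
      have h1 := x.2.2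
      exact hx ⟨_, ⟨by positivity, by nlinarith⟩, h⟩
    rw [this]
    simp

lemma arrivalLaw_closing_rod_le {ℓ η e : ℝ} (hℓ : 0 < ℓ) (hη : η ≤ 1 / 2) (he : e = 1 ∨ e = -1)
    (s j : ℕ) :
    arrivalLaw {ω | ℓ * (ω (s + 1 + j) : ℝ) ∈ offset e (ℓ * (ω s : ℝ)) (4 - η) 4 ∧
      ∀ r < s + 1 + j, r ≠ s → ℓ * (ω r : ℝ) ∉ offset e (ℓ * (ω s : ℝ)) 2 3} ≤
    ENNReal.ofReal ℓ⁻¹ * ENNReal.ofReal η * (1 - ENNReal.ofReal ℓ⁻¹) ^ (s + j) := by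
  let t := s + 1 + j
  let F : Finset ℕ := (Finset.range t).erase s
  have htF : t ∉ F := by simp [F]
  have hcard : F.card = s + j := by
    rw [Finset.card_erase_of_mem (by simp [t]; omega)]; simp [t]
  have hms : ∀ c d : ℝ, MeasurableSet {p : unitInterval × unitInterval |
      ℓ * (p.2 : ℝ) ∈ offset e (ℓ * (p.1 : ℝ)) c d} := fun c d =>
    (by fun_prop : Measurable fun p : unitInterval × unitInterval =>
      e * (ℓ * (p.2 : ℝ) - ℓ * (p.1 : ℝ))) measurableSet_Icc
  let B : ℕ → Set (unitInterval × unitInterval) := fun r =>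
    if r = t then {p | ℓ * (p.2 : ℝ) ∈ offset e (ℓ * (p.1 : ℝ)) (4 - η) 4}
    else {p | ℓ * (p.2 : ℝ) ∈ offset e (ℓ * (p.1 : ℝ)) 2 3}ᶜ
  have hB : ∀ r, MeasurableSet (B r) := fun r => by
    by_cases h : r = t
    · simpa only [B, h, if_true] using hms _ _
    · simpa only [B, h, if_false] using (hms _ _).compl
  refine (measure_mono ?_).trans (arrivalLaw_rect_le (s := s) (F := insert t F) (B := B) ?_ hB ?_)
  · rintro ω ⟨h1, h2⟩ r hr
    rcases Finset.mem_insert.1 hr with rfl | hr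
    · simpa [B] using h1
    · have hrt : r ≠ t := fun h => htF (h ▸ hr)
      simp only [F, Finset.mem_erase, Finset.mem_range] at hr
      simpa [B, hrt] using h2 r hr.2 hr.1
  · simp [F, t]; omega
  · intro x
    have e1 : ∏ r ∈ F, (volume : Measure unitInterval) (Prod.mk x ⁻¹' B r) =
        volume {y : unitInterval | ℓ * (y : ℝ) ∈ (offset e (ℓ * (x : ℝ)) 2 3)ᶜ} ^ (s + j) := by
      rw [← hcard]
      refine Finset.prod_eq_pow_card fun r hr => ?_
      have hrt : r ≠ t := fun h => htF (h ▸ hr)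
      simp only [B, hrt, if_false]
      rfl
    have e2 : (volume : Measure unitInterval) (Prod.mk x ⁻¹' B t) =
        volume {y : unitInterval | ℓ * (y : ℝ) ∈ offset e (ℓ * (x : ℝ)) (4 - η) 4} := by
      simp only [B, if_true]
      rfl
    rw [Finset.prod_insert htF, e1, e2]
    have h0 := x.2.1
    have h1 := x.2.2
    exact volume_closing_le hℓ hη he ⟨by nlinarith, by nlinarith⟩ _

lemma arrivalLaw_closing_wall_le {ℓ η e a : ℝ} (hℓ : 0 < ℓ) (hη : η ≤ 1 / 2) (he : e = 1 ∨ e = -1)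
    (ha : a ∈ Icc (-2) (ℓ + 2)) (t : ℕ) :
    arrivalLaw {ω | ℓ * (ω t : ℝ) ∈ offset e a (4 - η) 4 ∧
      ∀ r < t, ℓ * (ω r : ℝ) ∉ offset e a 2 3} ≤
    ENNReal.ofReal ℓ⁻¹ * ENNReal.ofReal η * (1 - ENNReal.ofReal ℓ⁻¹) ^ t := by
  have hms : ∀ c d : ℝ, MeasurableSet {x : unitInterval | ℓ * (x : ℝ) ∈ offset e a c d} :=
    fun c d => (by fun_prop : Measurable fun x : unitInterval => ℓ * (x : ℝ))
      (measurableSet_offset e a c d)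
  let B : ℕ → Set unitInterval := fun r =>
    if r = t then {x | ℓ * (x : ℝ) ∈ offset e a (4 - η) 4}
    else {x | ℓ * (x : ℝ) ∈ offset e a 2 3}ᶜ
  have hB : ∀ r, MeasurableSet (B r) := fun r => by
    by_cases h : r = t
    · simpa only [B, h, if_true] using hms _ _
    · simpa only [B, h, if_false] using (hms _ _).compl
  have hsub : {ω : Arrivals | ℓ * (ω t : ℝ) ∈ offset e a (4 - η) 4 ∧
      ∀ r < t, ℓ * (ω r : ℝ) ∉ offset e a 2 3} ⊆ Set.pi (insert t (Finset.range t) : Finset ℕ) B := by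
    rintro ω ⟨h1, h2⟩ r hr
    rcases Finset.mem_insert.1 (Finset.mem_coe.1 hr) with rfl | hr
    · simpa [B] using h1
    · have hr' := Finset.mem_range.1 hr
      simpa [B, hr'.ne] using h2 r hr'
  refine (measure_mono hsub).trans ?_
  unfold arrivalLaw
  rw [Measure.infinitePi_pi _ fun r _ => hB r, Finset.prod_insert (by simp)]
  have e1 : ∏ r ∈ Finset.range t, (volume : Measure unitInterval) (B r) =
      volume {y : unitInterval | ℓ * (y : ℝ) ∈ (offset e a 2 3)ᶜ} ^ t := by
    conv_rhs => rw [← Finset.card_range t]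
    refine Finset.prod_eq_pow_card fun r hr => ?_
    simp only [B, (Finset.mem_range.1 hr).ne, if_false]
    rfl
  rw [e1]
  simp only [B, if_true]
  exact volume_closing_le hℓ hη he ha _

lemma ennreal_tsum_geometric_one_sub {ℓ : ℝ} (hℓ : 1 ≤ ℓ) :
    ∑' n : ℕ, (1 - ENNReal.ofReal ℓ⁻¹) ^ n = ENNReal.ofReal ℓ := by
  have h1 : ENNReal.ofReal ℓ⁻¹ ≤ 1 := by
    rw [ENNReal.ofReal_le_one]; exact inv_le_one_of_one_le₀ hℓ
  rw [ENNReal.tsum_geometric, ENNReal.sub_sub_cancel (by simp) h1,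
    ENNReal.ofReal_inv_of_pos (by linarith), inv_inv]

/-- A gap of length at least `2 - η` occurs with probability at most `2 η L`. -/
lemma arrivalLaw_gapEvent_le {L η : ℝ} (hL : 3 ≤ L) (h0 : 0 ≤ η) (hη : η ≤ 1 / 2) :
    arrivalLaw (gapEvent L (2 - η)) ≤ ENNReal.ofReal (2 * (η * L)) := by
  have hℓ : 0 < L - 2 := by linarith
  set ℓ := L - 2 with hℓdef
  let R : ℝ → ℕ → ℕ → Set Arrivals := fun e s j =>
    {ω | ℓ * (ω (s + 1 + j) : ℝ) ∈ offset e (ℓ * (ω s : ℝ)) (4 - η) 4 ∧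
      ∀ r < s + 1 + j, r ≠ s → ℓ * (ω r : ℝ) ∉ offset e (ℓ * (ω s : ℝ)) 2 3}
  let W : ℝ → ℝ → ℕ → Set Arrivals := fun e a t =>
    {ω | ℓ * (ω t : ℝ) ∈ offset e a (4 - η) 4 ∧ ∀ r < t, ℓ * (ω r : ℝ) ∉ offset e a 2 3}
  have hae : ∀ᵐ ω ∂arrivalLaw, ∀ p q : ℚ, p < q → Ioo (p : ℝ) q ⊆ Icc 0 (L - 2) →
      ∃ t, candidate L ω t ∈ Ioo (p : ℝ) q := by
    refine ae_all_iff.2 fun p => ae_all_iff.2 fun q => ?_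
    by_cases h : p < q ∧ Ioo (p : ℝ) q ⊆ Icc 0 (L - 2)
    · filter_upwards [ae_frequently_candidate (by linarith) measurableSet_Ioo h.2
        (by simpa using h.1)] with ω hω _ _
      exact hω.exists
    · exact ae_of_all _ fun ω h1 h2 => absurd ⟨h1, h2⟩ h
  have hcover : gapEvent L (2 - η) ≤ᵐ[arrivalLaw]
      ((⋃ s, ⋃ j, R 1 s j) ∪ (⋃ s, ⋃ j, R (-1) s j) ∪
        ((⋃ t, W 1 (-2) t) ∪ ⋃ t, W (-1) (ℓ + 2) t) : Set Arrivals) := by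
    filter_upwards [hae] with ω hω hgapω
    obtain ⟨u, v, hg, hlen⟩ := hgapω
    have hle := gap_le_two (by linarith) hg hω
    obtain ⟨huv, hu, hv, hgap⟩ := hg
    have hc : ∀ r, ℓ * (ω r : ℝ) = candidate L ω r := fun r => rfl
    rcases hv with rfl | hv
    · rcases hu with rfl | hu
      · exfalso
        have h1 : candidate v ω 0 ∈ saturated v ω :=
          placed_subset_saturated v ω 1 (candidate_mem_placed fun y hy => hy.elim)
        have h2 := candidate_mem (by linarith) ω 0 (L := v)
        rcases hgap _ h1 with h | h <;> linarith [h2.1, h2.2]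
      · right; right
        obtain ⟨t, ht, hfree, -⟩ := exists_time_of_mem_saturated hu
        refine mem_iUnion.2 ⟨t, ?_, fun r hr => ?_⟩
        · rw [offset_neg_one, hc, ← ht]
          exact ⟨by linarith, by linarith⟩
        · rw [offset_neg_one, hc]
          have := candidate_notMem_of_left hgap (by linarith) hfree hr
          convert this using 3 <;> ring
    · obtain ⟨t, ht, hfree, hpl⟩ := exists_time_of_mem_saturated hv
      rcases hu with rfl | hu
      · right; left
        refine mem_iUnion.2 ⟨t, ?_, fun r hr => ?_⟩
        · rw [offset_one, hc, ← ht]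
          exact ⟨by linarith, by linarith⟩
        · rw [offset_one, hc]
          have := candidate_notMem_of_right hgap (by linarith) hfree hr
          convert this using 2; norm_num
      · left
        obtain ⟨s, hs, hfree', hpl'⟩ := exists_time_of_mem_saturated hu
        rcases lt_trichotomy s t with h | h | h
        · left
          obtain ⟨j, rfl⟩ := Nat.exists_eq_add_of_le (Nat.succ_le_of_lt h)
          refine mem_iUnion₂.2 ⟨s, j, ?_, fun r hr hrs => ?_⟩
          · rw [offset_one, hc, hc, ← hs, ← ht]
            exact ⟨by linarith, by linarith⟩
          · rw [offset_one, hc, hc, ← hs]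
            have := candidate_notMem_of_right hgap (by linarith) hfree hr
            convert this using 2; congr 1 <;> ring
        · subst h
          linarith
        · right
          obtain ⟨j, rfl⟩ := Nat.exists_eq_add_of_le (Nat.succ_le_of_lt h)
          refine mem_iUnion₂.2 ⟨t, j, ?_, fun r hr hrs => ?_⟩
          · rw [offset_neg_one, hc, hc, ← hs, ← ht]
            exact ⟨by linarith, by linarith⟩
          · rw [offset_neg_one, hc, hc, ← ht]
            exact candidate_notMem_of_left hgap (by linarith) hfree' hr
  have hℓ1 : 1 ≤ ℓ := by linarith
  have hR : ∀ e : ℝ, e = 1 ∨ e = -1 →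
      arrivalLaw (⋃ s, ⋃ j, R e s j) ≤ ENNReal.ofReal (η * ℓ) := by
    intro e he
    calc arrivalLaw (⋃ s, ⋃ j, R e s j)
        ≤ ∑' s, ∑' j, arrivalLaw (R e s j) :=
          (measure_iUnion_le _).trans (ENNReal.tsum_le_tsum fun s => measure_iUnion_le _)
      _ ≤ ∑' s : ℕ, ∑' j : ℕ, ENNReal.ofReal ℓ⁻¹ * ENNReal.ofReal η *
            (1 - ENNReal.ofReal ℓ⁻¹) ^ (s + j) :=
          ENNReal.tsum_le_tsum fun s => ENNReal.tsum_le_tsum fun j =>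
            arrivalLaw_closing_rod_le hℓ hη he s j
      _ = ENNReal.ofReal (η * ℓ) := by
          simp_rw [pow_add, ENNReal.tsum_mul_left, ENNReal.tsum_mul_right,
            ennreal_tsum_geometric_one_sub hℓ1]
          rw [← ENNReal.ofReal_mul (by positivity), ← ENNReal.ofReal_mul (by positivity),
            ← ENNReal.ofReal_mul (by positivity)]
          congr 1; field_simp
  have hW : ∀ e a : ℝ, e = 1 ∨ e = -1 → a ∈ Icc (-2) (ℓ + 2) →
      arrivalLaw (⋃ t, W e a t) ≤ ENNReal.ofReal η := by
    intro e a he ha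
    calc arrivalLaw (⋃ t, W e a t)
        ≤ ∑' t, arrivalLaw (W e a t) := measure_iUnion_le _
      _ ≤ ∑' t : ℕ, ENNReal.ofReal ℓ⁻¹ * ENNReal.ofReal η * (1 - ENNReal.ofReal ℓ⁻¹) ^ t :=
          ENNReal.tsum_le_tsum fun t => arrivalLaw_closing_wall_le hℓ hη he ha t
      _ = ENNReal.ofReal η := by
          rw [ENNReal.tsum_mul_left, ennreal_tsum_geometric_one_sub hℓ1,
            ← ENNReal.ofReal_mul (by positivity), ← ENNReal.ofReal_mul (by positivity)]
          congr 1; field_simp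
  calc arrivalLaw (gapEvent L (2 - η))
      ≤ (ENNReal.ofReal (η * ℓ) + ENNReal.ofReal (η * ℓ)) +
          (ENNReal.ofReal η + ENNReal.ofReal η) := by
        refine (measure_mono_ae hcover).trans ((measure_union_le _ _).trans (add_le_add ?_ ?_))
        · exact (measure_union_le _ _).trans
            (add_le_add (hR 1 (Or.inl rfl)) (hR (-1) (Or.inr rfl)))
        · exact (measure_union_le _ _).trans
            (add_le_add (hW 1 (-2) (Or.inl rfl) ⟨le_rfl, by linarith⟩)
              (hW (-1) (ℓ + 2) (Or.inr rfl) ⟨by linarith, le_rfl⟩))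
    _ = ENNReal.ofReal ((η * ℓ + η * ℓ) + (η + η)) := by
        rw [ENNReal.ofReal_add (by positivity) (by positivity),
          ENNReal.ofReal_add (by positivity) (by positivity), ENNReal.ofReal_add h0 h0]
    _ ≤ _ := ENNReal.ofReal_le_ofReal (by rw [hℓdef]; nlinarith)

lemma gapEvent_anti (L : ℝ) : Antitone (gapEvent L) := fun _ _ h _ ⟨u, v, hg, hr⟩ =>
  ⟨u, v, hg, h.trans hr⟩

lemma withHighProbability_of_compl {E : ℝ → Set Arrivals}
    (h : Tendsto (fun L => arrivalLaw (E L)ᶜ) atTop (𝓝 0)) : WithHighProbability E := by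
  have h1 : Tendsto (fun L => 1 - arrivalLaw (E L)ᶜ) atTop (𝓝 (1 - 0)) :=
    ENNReal.Tendsto.sub tendsto_const_nhds h (by simp)
  rw [tsub_zero] at h1
  refine tendsto_of_tendsto_of_tendsto_of_le_of_le h1 tendsto_const_nhds (fun L => ?_)
    fun L => prob_le_one
  have := measure_union_le (μ := arrivalLaw) (E L) (E L)ᶜ
  rw [union_compl_self, measure_univ] at this
  exact tsub_le_iff_right.2 this

theorem withHighProbability_no_large_gap {η : ℝ → ℝ} (hη : η =o[atTop] (fun L : ℝ => 1 / L)) :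
    WithHighProbability fun L => (gapEvent L (2 - η L))ᶜ := by
  refine withHighProbability_of_compl ?_
  simp only [compl_compl]
  have hlim : Tendsto (fun L : ℝ => |η L| * L) atTop (𝓝 0) := by
    have := hη.tendsto_div_nhds_zero.abs
    rw [abs_zero] at this
    refine this.congr' ?_
    filter_upwards [eventually_gt_atTop 0] with L hL
    rw [one_div, div_inv_eq_mul, abs_mul, abs_of_pos hL]
  have hlim2 : Tendsto (fun L : ℝ => ENNReal.ofReal (2 * (|η L| * L))) atTop (𝓝 0) := by
    have := ENNReal.tendsto_ofReal (hlim.const_mul 2)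
    simpa using this
  refine tendsto_of_tendsto_of_tendsto_of_le_of_le' tendsto_const_nhds hlim2
    (Eventually.of_forall fun _ => zero_le) ?_
  filter_upwards [eventually_ge_atTop 3, hlim.eventually_le_const (by norm_num : (0 : ℝ) < 1 / 2)]
    with L hL h
  refine (measure_mono (gapEvent_anti L (by linarith [le_abs_self (η L)] : 2 - |η L| ≤ _))).trans
    (arrivalLaw_gapEvent_le hL (abs_nonneg _) ?_)
  nlinarith [abs_nonneg (η L)]

/-- State of the `k`-th block `[10 k, 10 k + 10)` after an arrival at `v` in this block. A state
`(0, _)` means that no candidate has arrived in the block, `(1, y)` that the only one arrived at `y`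
and has been placed, `(2, _)` that the block is spoiled, and `(3, _)` that its first two candidates
are adjacent rods around a gap of length in `[2 - η, 2)`. -/
noncomputable def blockStep (η : ℝ) (k : ℕ) (σ : ℕ × ℝ) (v : ℝ) : ℕ × ℝ :=
  if σ.1 = 0 then if v ∈ Ico (10 * k + 2 : ℝ) (10 * k + 4) then (1, v) else (2, v)
  else if σ.1 = 1 then if v ∈ Ico (σ.2 + 4 - η) (σ.2 + 4) then (3, σ.2) else (2, σ.2)
  else σ

/-- The probability that a block in the given state never encloses a gap of length in
`[2 - η, 2)`. -/
noncomputable def blockWeight (η : ℝ) (k : ℕ) (σ : ℕ × ℝ) : ENNReal :=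
  if σ.1 = 0 then ENNReal.ofReal (1 - η / 50)
  else if σ.1 = 1 then
    if σ.2 ∈ Ico (10 * k + 2 : ℝ) (10 * k + 4) then ENNReal.ofReal (1 - η / 10) else 1
  else if σ.1 = 2 then 1 else 0

/-- States of all blocks after the arrival of the candidate `ℓ * x`. -/
noncomputable def stateStep (ℓ η : ℝ) (s : ℕ → ℕ × ℝ) (x : unitInterval) : ℕ → ℕ × ℝ := fun k =>
  if ⌊ℓ * (x : ℝ) / 10⌋₊ = k then blockStep η k (s k) (ℓ * (x : ℝ)) else s k

/-- The states of all blocks after the arrivals at the times `0, …, t - 1`. -/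
noncomputable def state (ℓ η : ℝ) : ℕ → Arrivals → ℕ → ℕ × ℝ
  | 0 => fun _ _ => (0, 0)
  | t + 1 => fun ω => stateStep ℓ η (state ℓ η t ω) (ω t)

lemma measurable_blockStep (η : ℝ) (k : ℕ) :
    Measurable fun p : (ℕ × ℝ) × ℝ => blockStep η k p.1 p.2 := by
  have hn : ∀ n : ℕ, MeasurableSet {p : (ℕ × ℝ) × ℝ | p.1.1 = n} := fun n =>
    (by fun_prop : Measurable fun p : (ℕ × ℝ) × ℝ => p.1.1) (measurableSet_singleton n)
  unfold blockStep
  refine Measurable.ite (hn 0) (Measurable.ite ?_ (by fun_prop) (by fun_prop))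
    (Measurable.ite (hn 1) (Measurable.ite ?_ (by fun_prop) (by fun_prop)) (by fun_prop))
  · exact measurable_snd measurableSet_Ico
  · have h1 : Measurable fun p : (ℕ × ℝ) × ℝ => p.1.2 + 4 - η := by fun_prop
    have h2 : Measurable fun p : (ℕ × ℝ) × ℝ => p.1.2 + 4 := by fun_prop
    exact (measurableSet_le h1 measurable_snd).inter (measurableSet_lt measurable_snd h2)

lemma measurable_blockWeight (η : ℝ) (k : ℕ) : Measurable (blockWeight η k) := by
  have hn : ∀ n : ℕ, MeasurableSet {p : ℕ × ℝ | p.1 = n} := fun n =>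
    measurable_fst (measurableSet_singleton n)
  unfold blockWeight
  refine Measurable.ite (hn 0) (by fun_prop)
    (Measurable.ite (hn 1) (Measurable.ite ?_ (by fun_prop) (by fun_prop))
      (Measurable.ite (hn 2) (by fun_prop) (by fun_prop)))
  exact measurable_snd measurableSet_Ico

lemma measurable_block (ℓ : ℝ) : Measurable fun x : unitInterval => ⌊ℓ * (x : ℝ) / 10⌋₊ :=
  Nat.measurable_floor.comp (by fun_prop)

lemma measurable_stateStep (ℓ η : ℝ) : Measurable (Function.uncurry (stateStep ℓ η)) := by
  refine measurable_pi_iff.2 fun k => ?_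
  refine Measurable.ite ?_ ?_ ?_
  · exact ((measurable_block ℓ).comp measurable_snd) (measurableSet_singleton k)
  · exact (measurable_blockStep η k).comp
      (((measurable_pi_apply k).comp measurable_fst).prodMk
        (by fun_prop : Measurable fun p : (ℕ → ℕ × ℝ) × unitInterval => ℓ * (p.2 : ℝ)))
  · exact (measurable_pi_apply k).comp measurable_fst

lemma block_eq_iff {ℓ : ℝ} (hℓ : 0 < ℓ) (x : unitInterval) (k : ℕ) :
    ⌊ℓ * (x : ℝ) / 10⌋₊ = k ↔ ℓ * (x : ℝ) ∈ Ico (10 * k : ℝ) (10 * k + 10) := by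
  have h0 := x.2.1
  rw [Nat.floor_eq_iff (by positivity), mem_Ico]
  exact and_congr ⟨fun h => by linarith, fun h => by linarith⟩
    ⟨fun h => by linarith, fun h => by linarith⟩

lemma setLIntegral_ite_le {α : Type*} [MeasurableSpace α] {μ : Measure α} {A J : Set α}
    (hA : MeasurableSet A) (hJ : MeasurableSet J) (hJA : J ⊆ A) {p c d q : ℝ}
    (hp : 0 ≤ p) (hc : 0 ≤ c) (hq : 0 ≤ q) (hqp : q ≤ p) (hμA : μ A = ENNReal.ofReal p)
    (hμJ : μ J = ENNReal.ofReal q) (h : p - q + q * c ≤ p * d) {f : α → ENNReal}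
    (hfJ : ∀ x ∈ J, f x = ENNReal.ofReal c) (hf : ∀ x ∈ A \ J, f x = 1) :
    ∫⁻ x in A, f x ∂μ ≤ μ A * ENNReal.ofReal d := by
  have hsplit : ∫⁻ x in A, f x ∂μ = ∫⁻ x in J, f x ∂μ + ∫⁻ x in A \ J, f x ∂μ := by
    rw [← lintegral_union (hA.diff hJ) disjoint_sdiff_right, union_sdiff_cancel hJA]
  rw [hsplit, setLIntegral_congr_fun hJ hfJ, setLIntegral_congr_fun (hA.diff hJ) hf,
    setLIntegral_const, setLIntegral_const, measure_sdiff hJA hJ.nullMeasurableSet (by simp [hμJ]),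
    hμA, hμJ, ← ENNReal.ofReal_sub _ hq, one_mul, ← ENNReal.ofReal_mul hc, ← ENNReal.ofReal_mul hp,
    ← ENNReal.ofReal_add (by positivity) (by linarith)]
  exact ENNReal.ofReal_le_ofReal (by linarith)

lemma setLIntegral_blockWeight_le {ℓ η : ℝ} (hη0 : 0 ≤ η) (hη : η ≤ 1) {k : ℕ}
    (hk : 10 * (k : ℝ) + 10 ≤ ℓ) (σ : ℕ × ℝ) :
    ∫⁻ x in {x : unitInterval | ⌊ℓ * (x : ℝ) / 10⌋₊ = k}, blockWeight η k (blockStep η k σ (ℓ * x)) ≤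
      volume {x : unitInterval | ⌊ℓ * (x : ℝ) / 10⌋₊ = k} * blockWeight η k σ := by
  have hk0 : (0 : ℝ) ≤ k := k.cast_nonneg
  have hℓ : 0 < ℓ := by linarith
  set A : Set unitInterval := {x | ⌊ℓ * (x : ℝ) / 10⌋₊ = k} with hAdef
  have hA : MeasurableSet A := measurable_block ℓ (measurableSet_singleton k)
  have hmem : ∀ x, x ∈ A ↔ ℓ * (x : ℝ) ∈ Ico (10 * k : ℝ) (10 * k + 10) := fun x =>
    block_eq_iff hℓ x k
  have hvol : ∀ a b : ℝ, 10 * k ≤ a → b ≤ 10 * k + 10 →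
      (volume : Measure unitInterval) {x : unitInterval | ℓ * (x : ℝ) ∈ Ico a b} =
        ENNReal.ofReal (ℓ⁻¹ * (b - a)) := fun a b ha hb => by
    rw [volume_candidate_of_subset hℓ measurableSet_Ico fun y hy =>
      ⟨by linarith [hy.1], by linarith [hy.2]⟩, Real.volume_Ico, ENNReal.ofReal_mul (by positivity)]
  have hmeas : ∀ a b : ℝ, MeasurableSet {x : unitInterval | ℓ * (x : ℝ) ∈ Ico a b} := fun a b =>
    (by fun_prop : Measurable fun x : unitInterval => ℓ * (x : ℝ)) measurableSet_Ico
  have hμA : (volume : Measure unitInterval) A = ENNReal.ofReal (ℓ⁻¹ * 10) := by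
    rw [show A = {x : unitInterval | ℓ * (x : ℝ) ∈ Ico (10 * k : ℝ) (10 * k + 10)} from
      Set.ext hmem, hvol _ _ le_rfl le_rfl]
    congr 2; ring
  have hi : 0 < ℓ⁻¹ := by positivity
  have hconst : ∀ τ : ℕ × ℝ, (∀ v, blockStep η k τ v = τ) →
      ∫⁻ x in A, blockWeight η k (blockStep η k τ (ℓ * x)) ≤ volume A * blockWeight η k τ := by
    intro τ h
    simp_rw [h]
    rw [setLIntegral_const, mul_comm]
  obtain ⟨n, y⟩ := σ
  rcases n with _ | _ | n
  · have hJ : {x : unitInterval | ℓ * (x : ℝ) ∈ Ico (10 * k + 2 : ℝ) (10 * k + 4)} ⊆ A := by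
      intro x hx
      rw [hmem]
      exact ⟨by linarith [hx.1], by linarith [hx.2]⟩
    have hw : blockWeight η k (0, y) = ENNReal.ofReal (1 - η / 50) := by simp [blockWeight]
    rw [hw]
    refine setLIntegral_ite_le hA (hmeas _ _) hJ (c := 1 - η / 10) (by positivity)
      (by linarith) ?_ ?_ hμA (hvol _ _ (by linarith) (by linarith)) ?_ ?_ ?_
    · rw [show (10 * k + 4 - (10 * k + 2) : ℝ) = 2 by ring]; positivity
    · rw [show (10 * k + 4 - (10 * k + 2) : ℝ) = 2 by ring]; nlinarith
    · rw [show (10 * k + 4 - (10 * k + 2) : ℝ) = 2 by ring]; nlinarith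
    · intro x hx
      have hx' : ℓ * (x : ℝ) ∈ Ico (10 * k + 2 : ℝ) (10 * k + 4) := hx
      simp only [blockStep, hx', if_true, blockWeight]
      simp
    · rintro x ⟨-, hx⟩
      have hx' : ℓ * (x : ℝ) ∉ Ico (10 * k + 2 : ℝ) (10 * k + 4) := hx
      simp only [blockStep, hx', if_true, if_false, blockWeight]
      simp
  · by_cases hy : y ∈ Ico (10 * k + 2 : ℝ) (10 * k + 4)
    · have hJ : {x : unitInterval | ℓ * (x : ℝ) ∈ Ico (y + 4 - η) (y + 4)} ⊆ A := by
        intro x hx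
        rw [hmem]
        exact ⟨by linarith [hx.1, hy.1], by linarith [hx.2, hy.2]⟩
      have hw : blockWeight η k (0 + 1, y) = ENNReal.ofReal (1 - η / 10) := by
        simp only [blockWeight, hy, if_true]
        simp
      rw [hw]
      refine setLIntegral_ite_le hA (hmeas _ _) hJ (c := 0) (by positivity)
        le_rfl ?_ ?_ hμA
        (hvol _ _ (by linarith [hy.1]) (by linarith [hy.2])) ?_ ?_ ?_
      · rw [show y + 4 - (y + 4 - η) = η by ring]; positivity
      · rw [show y + 4 - (y + 4 - η) = η by ring]; nlinarith
      · rw [show y + 4 - (y + 4 - η) = η by ring]; nlinarith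
      · intro x hx
        have hx' : ℓ * (x : ℝ) ∈ Ico (y + 4 - η) (y + 4) := hx
        simp only [blockStep, hx', if_true, blockWeight]
        simp
      · rintro x ⟨-, hx⟩
        have hx' : ℓ * (x : ℝ) ∉ Ico (y + 4 - η) (y + 4) := hx
        simp only [blockStep, hx', if_false, blockWeight]
        simp
    · have hw : blockWeight η k (0 + 1, y) = 1 := by
        simp only [blockWeight, hy, if_false]
        simp
      rw [hw, mul_one]
      refine (setLIntegral_mono measurable_const (g := fun _ => 1) fun x _ => ?_).trans (by simp)
      by_cases hx : ℓ * (x : ℝ) ∈ Ico (y + 4 - η) (y + 4)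
      · simp only [blockStep, hx, if_true, blockWeight]
        simp
      · simp only [blockStep, hx, if_false, blockWeight]
        simp
  · exact hconst _ fun v => by simp [blockStep]

lemma lintegral_prod_blockWeight_le {ℓ η : ℝ} (hη0 : 0 ≤ η) (hη : η ≤ 1) {K : ℕ}
    (hK : 10 * (K : ℝ) ≤ ℓ) (s : ℕ → ℕ × ℝ) :
    ∫⁻ x, ∏ k ∈ Finset.range K, blockWeight η k (stateStep ℓ η s x k) ≤
      ∏ k ∈ Finset.range K, blockWeight η k (s k) := by
  set φ : (ℕ → ℕ × ℝ) → ENNReal := fun s => ∏ k ∈ Finset.range K, blockWeight η k (s k) with hφ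
  set A : ℕ → Set unitInterval := fun k => {x | ⌊ℓ * (x : ℝ) / 10⌋₊ = k} with hAdef
  have hA : ∀ k, MeasurableSet (A k) := fun k => measurable_block ℓ (measurableSet_singleton k)
  have hdisj : Pairwise (Function.onFun Disjoint A) := fun i j hij =>
    disjoint_left.2 fun x hi hj => hij (Eq.trans (Eq.symm hi) hj)
  have hunion : ⋃ k, A k = univ := eq_univ_of_forall fun x => mem_iUnion.2 ⟨_, rfl⟩
  have hk : ∀ k, ∫⁻ x in A k, φ (stateStep ℓ η s x) ≤ volume (A k) * φ s := by
    intro k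
    have hother : ∀ x ∈ A k, ∀ j, j ≠ k → stateStep ℓ η s x j = s j := fun x hx j hj => by
      have hx' : ⌊ℓ * (x : ℝ) / 10⌋₊ = k := hx
      simp [stateStep, hx', hj.symm]
    by_cases hkK : k < K
    · have hmem : k ∈ Finset.range K := Finset.mem_range.2 hkK
      set P := ∏ j ∈ (Finset.range K).erase k, blockWeight η j (s j)
      have e1 : φ s = blockWeight η k (s k) * P := (Finset.mul_prod_erase _ _ hmem).symm
      have e2 : ∀ x ∈ A k, φ (stateStep ℓ η s x) =
          blockWeight η k (blockStep η k (s k) (ℓ * x)) * P := by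
        intro x hx
        rw [hφ]
        simp only
        rw [← Finset.mul_prod_erase _ _ hmem]
        congr 1
        · have hx' : ⌊ℓ * (x : ℝ) / 10⌋₊ = k := hx
          simp [stateStep, hx']
        · exact Finset.prod_congr rfl fun j hj => by rw [hother x hx j (Finset.ne_of_mem_erase hj)]
      have hmeas : Measurable fun x : unitInterval =>
          blockWeight η k (blockStep η k (s k) (ℓ * x)) :=
        (measurable_blockWeight η k).comp ((measurable_blockStep η k).comp
          (by fun_prop : Measurable fun x : unitInterval => (s k, ℓ * (x : ℝ))))
      rw [setLIntegral_congr_fun (hA k) e2, lintegral_mul_const _ hmeas, e1, ← mul_assoc]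
      gcongr
      refine setLIntegral_blockWeight_le hη0 hη ?_ _
      have : (k : ℝ) + 1 ≤ K := by exact_mod_cast hkK
      linarith
    · have e2 : ∀ x ∈ A k, φ (stateStep ℓ η s x) = φ s := fun x hx =>
        Finset.prod_congr rfl fun j hj => by
          rw [hother x hx j fun h => hkK (h ▸ Finset.mem_range.1 hj)]
      rw [setLIntegral_congr_fun (hA k) e2, setLIntegral_const, mul_comm]
  calc ∫⁻ x, φ (stateStep ℓ η s x)
      = ∑' k, ∫⁻ x in A k, φ (stateStep ℓ η s x) := by
        rw [← lintegral_iUnion hA hdisj, hunion, Measure.restrict_univ]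
    _ ≤ ∑' k, volume (A k) * φ s := ENNReal.tsum_le_tsum hk
    _ = φ s := by
        rw [ENNReal.tsum_mul_right, ← measure_iUnion hdisj hA, hunion, measure_univ, one_mul]

section Paths

variable {L η : ℝ} {ω : Arrivals}

lemma state_succ (hL : 2 < L) (t k : ℕ) : state (L - 2) η (t + 1) ω k =
    if candidate L ω t ∈ Ico (10 * k : ℝ) (10 * k + 10) then
      blockStep η k (state (L - 2) η t ω k) (candidate L ω t)
    else state (L - 2) η t ω k := by
  simp only [state, stateStep, block_eq_iff (by linarith : 0 < L - 2)]
  rfl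

lemma eq_or_outside_block_of_mem_placed {k t : ℕ} {y : ℝ}
    (h : ∀ r < t, candidate L ω r ∈ Ico (10 * k : ℝ) (10 * k + 10) → candidate L ω r = y) {x : ℝ}
    (hx : x ∈ placed L ω t) : x < 10 * k ∨ 10 * k + 10 ≤ x ∨ x = y := by
  obtain ⟨r, hr, rfl, -⟩ := exists_time_of_mem_placed hx
  by_contra! hcon
  exact hcon.2.2 (h r hr ⟨hcon.1, hcon.2.1⟩)

lemma state_spec (hL : 2 < L) (hη : η ≤ 1) (k t : ℕ) :
    ((state (L - 2) η t ω k).1 = 0 →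
      ∀ r < t, candidate L ω r ∉ Ico (10 * k : ℝ) (10 * k + 10)) ∧
    ((state (L - 2) η t ω k).1 = 1 →
      (state (L - 2) η t ω k).2 ∈ Ico (10 * k + 2 : ℝ) (10 * k + 4) ∧
      (state (L - 2) η t ω k).2 ∈ placed L ω t ∧
      ∀ r < t, candidate L ω r ∈ Ico (10 * k : ℝ) (10 * k + 10) →
        candidate L ω r = (state (L - 2) η t ω k).2) ∧
    (3 ≤ (state (L - 2) η t ω k).1 →
      ∃ y ∈ placed L ω t, ∃ v ∈ placed L ω t, v ∈ Ico (y + 4 - η) (y + 4)) := by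
  induction t with
  | zero => simp [state]
  | succ t ih =>
    rw [state_succ hL]
    set σ := state (L - 2) η t ω k
    set v := candidate L ω t with hv
    obtain ⟨ih0, ih1, ih3⟩ := ih
    have hmono := placed_mono L ω t.le_succ
    by_cases hvk : v ∈ Ico (10 * k : ℝ) (10 * k + 10)
    · simp only [hvk, if_true]
      unfold blockStep
      split_ifs with h0 hg h1 hg
      · have hfree : v ∈ placed L ω (t + 1) := by
          refine candidate_mem_placed fun x hx => ?_
          obtain ⟨r, hr, rfl, -⟩ := exists_time_of_mem_placed hx
          have hr' := ih0 h0 r hr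
          rw [mem_Ico, not_and_or, not_le, not_lt] at hr'
          rcases hr' with h | h
          · exact le_abs.2 (Or.inl (by linarith [hg.1]))
          · exact le_abs.2 (Or.inr (by linarith [hg.2]))
        refine ⟨by simp, fun _ => ⟨hg, hfree, fun r hr hrk => ?_⟩, by simp⟩
        rcases Nat.lt_succ_iff_lt_or_eq.1 hr with h | rfl
        · exact absurd hrk (ih0 h0 r h)
        · rfl
      · simp
      · refine ⟨by simp, by simp, fun _ => ?_⟩
        obtain ⟨hy, hyp, hyk⟩ := ih1 h1
        refine ⟨σ.2, hmono hyp, v, candidate_mem_placed fun x hx => ?_, hg⟩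
        rcases eq_or_outside_block_of_mem_placed hyk hx with h | h | h
        · exact le_abs.2 (Or.inl (by linarith [hg.1, hy.1]))
        · exact le_abs.2 (Or.inr (by linarith [hg.2, hy.2]))
        · exact le_abs.2 (Or.inl (by linarith [hg.1]))
      · simp
      · refine ⟨fun h => absurd h h0, fun h => absurd h h1, fun h => ?_⟩
        obtain ⟨y, hy, w, hw, hyw⟩ := ih3 h
        exact ⟨y, hmono hy, w, hmono hw, hyw⟩
    · simp only [hvk, if_false]
      refine ⟨fun h r hr => ?_, fun h => ⟨(ih1 h).1, hmono (ih1 h).2.1, fun r hr hrk => ?_⟩,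
        fun h => ?_⟩
      · rcases Nat.lt_succ_iff_lt_or_eq.1 hr with h' | rfl
        · exact ih0 h r h'
        · exact hvk
      · rcases Nat.lt_succ_iff_lt_or_eq.1 hr with h' | rfl
        · exact (ih1 h).2.2 r h' hrk
        · exact absurd hrk hvk
      · obtain ⟨y, hy, w, hw, hyw⟩ := ih3 h
        exact ⟨y, hmono hy, w, hmono hw, hyw⟩

lemma mem_innerGapEvent_of_adjacent (hη : η ≤ 1) {y v : ℝ} (hy : y ∈ saturated L ω)
    (hv : v ∈ saturated L ω) (hyv : v ∈ Ico (y + 4 - η) (y + 4)) :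
    ω ∈ innerGapEvent L (2 - η) := by
  refine ⟨y + 2, v, ⟨by linarith [hyv.1], by simpa using hy, hv, fun x hx => ?_⟩,
    by linarith [hyv.1]⟩
  by_contra! h
  have h1 := two_le_abs_sub hx hy (by linarith [h.1] : y < x).ne'
  have h2 := two_le_abs_sub hx hv h.2.ne
  rw [abs_of_pos (by linarith)] at h1
  rw [abs_of_neg (by linarith)] at h2
  linarith [hyv.2]

lemma mem_innerGapEvent_of_state (hL : 2 < L) (hη : η ≤ 1) {k t : ℕ}
    (h : 3 ≤ (state (L - 2) η t ω k).1) : ω ∈ innerGapEvent L (2 - η) := by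
  obtain ⟨y, hy, v, hv, hyv⟩ := (state_spec hL hη k t).2.2 h
  exact mem_innerGapEvent_of_adjacent hη (placed_subset_saturated L ω t hy)
    (placed_subset_saturated L ω t hv) hyv

lemma state_monotone (hL : 2 < L) (k : ℕ) : Monotone fun t => (state (L - 2) η t ω k).1 := by
  refine monotone_nat_of_le_succ fun t => ?_
  rw [state_succ hL]
  unfold blockStep
  split_ifs <;> simp_all

lemma state_lt_succ (hL : 2 < L) {k t : ℕ}
    (ht : candidate L ω t ∈ Ico (10 * k : ℝ) (10 * k + 10)) :
    2 ≤ (state (L - 2) η (t + 1) ω k).1 ∨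
      (state (L - 2) η t ω k).1 < (state (L - 2) η (t + 1) ω k).1 := by
  rw [state_succ hL, if_pos ht]
  unfold blockStep
  split_ifs <;> simp_all
  omega

lemma eventually_two_le_state (hL : 2 < L) {k : ℕ}
    (h : ∃ᶠ t in atTop, candidate L ω t ∈ Ico (10 * k : ℝ) (10 * k + 10)) :
    ∀ᶠ t in atTop, 2 ≤ (state (L - 2) η t ω k).1 := by
  obtain ⟨s, -, hs⟩ := frequently_atTop.1 h 0
  obtain ⟨t, hst, ht⟩ := frequently_atTop.1 h (s + 1)
  have h1 := state_lt_succ (η := η) hL hs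
  have h2 := state_lt_succ (η := η) hL ht
  have h3 := state_monotone (η := η) (ω := ω) hL k hst
  have h4 := state_monotone (η := η) (ω := ω) hL k t.le_succ
  simp only [Nat.succ_eq_add_one] at h3 h4
  filter_upwards [eventually_ge_atTop (t + 1)] with r hr
  have h5 := state_monotone (η := η) (ω := ω) hL k hr
  simp only at h5
  omega

end Paths

/-- The probability of no inner gap of length at least `2 - η` is at most that of no block enclosing
one. -/
lemma arrivalLaw_compl_innerGapEvent_le_pow {L η : ℝ} (hL : 2 < L) (hη0 : 0 ≤ η) (hη : η ≤ 1)
    {K : ℕ} (hK : 10 * (K : ℝ) ≤ L - 2) :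
    arrivalLaw (innerGapEvent L (2 - η))ᶜ ≤ ENNReal.ofReal (1 - η / 50) ^ K := by
  let φ : (ℕ → ℕ × ℝ) → ENNReal := fun s => ∏ k ∈ Finset.range K, blockWeight η k (s k)
  have hφ : Measurable φ := Finset.measurable_fun_prod _ fun k _ =>
    (measurable_blockWeight η k).comp (measurable_pi_apply k)
  have hchain := fun t => lintegral_chain_le (measurable_stateStep (L - 2) η) hφ
    (lintegral_prod_blockWeight_le hη0 hη hK) (state := state (L - 2) η) (s₀ := fun _ => (0, 0))
    (fun ω => rfl) (fun t ω => rfl) t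
  have hhit : ∀ᵐ ω ∂arrivalLaw, ∀ k : ℕ, k < K →
      ∃ᶠ t in atTop, candidate L ω t ∈ Ico (10 * k : ℝ) (10 * k + 10) := by
    refine ae_all_iff.2 fun k => ?_
    by_cases hk : k < K
    · have h1 : (k : ℝ) + 1 ≤ K := by exact_mod_cast hk
      have h0 : (0 : ℝ) ≤ k := k.cast_nonneg
      filter_upwards [ae_frequently_candidate hL (B := Ico (10 * k : ℝ) (10 * k + 10))
        measurableSet_Ico (fun y hy => ⟨by linarith [hy.1], by linarith [hy.2]⟩) (by simp)]
        with ω h _ using h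
    · exact ae_of_all _ fun ω h => absurd h hk
  have hsub : ((innerGapEvent L (2 - η))ᶜ : Set Arrivals) ≤ᵐ[arrivalLaw]
      {ω | 1 ≤ liminf (fun t => φ (state (L - 2) η t ω)) atTop} := by
    filter_upwards [hhit] with ω hω hno
    have hev : ∀ᶠ t in atTop, ∀ k ∈ Finset.range K, 2 ≤ (state (L - 2) η t ω k).1 :=
      (Finset.range K).eventually_all.2 fun k hk =>
        eventually_two_le_state hL (hω k (Finset.mem_range.1 hk))
    refine le_liminf_of_le (by isBoundedDefault) ?_
    filter_upwards [hev] with t ht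
    refine (Finset.prod_eq_one fun k hk => ?_).ge
    have h2 : (state (L - 2) η t ω k).1 = 2 := by
      refine le_antisymm ?_ (ht k hk)
      by_contra! h3
      exact hno (mem_innerGapEvent_of_state hL hη h3)
    simp [blockWeight, h2]
  calc arrivalLaw (innerGapEvent L (2 - η))ᶜ
      ≤ arrivalLaw {ω | 1 ≤ liminf (fun t => φ (state (L - 2) η t ω)) atTop} :=
        measure_mono_ae hsub
    _ ≤ ∫⁻ ω, liminf (fun t => φ (state (L - 2) η t ω)) atTop ∂arrivalLaw := by
        have := mul_meas_ge_le_lintegral₀ (μ := arrivalLaw)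
          (Measurable.liminf fun t => hφ.comp (hchain t).1).aemeasurable 1
        rwa [one_mul] at this
    _ ≤ liminf (fun t => ∫⁻ ω, φ (state (L - 2) η t ω) ∂arrivalLaw) atTop :=
        lintegral_liminf_le fun t => hφ.comp (hchain t).1
    _ ≤ φ fun _ => (0, 0) := by
        refine (liminf_le_liminf (Eventually.of_forall fun t => (hchain t).2)).trans_eq ?_
        exact liminf_const _
    _ = _ := by simp [φ, blockWeight]

lemma arrivalLaw_compl_innerGapEvent_le {L η : ℝ} (hL : 24 ≤ L) (hη0 : 0 ≤ η) (hη : η ≤ 1) :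
    arrivalLaw (innerGapEvent L (2 - η))ᶜ ≤ ENNReal.ofReal (Real.exp (-(η * L / 1000))) := by
  set K := ⌊(L - 2) / 10⌋₊
  have h1 : (K : ℝ) ≤ (L - 2) / 10 := Nat.floor_le (by linarith)
  have h2 : (L - 2) / 10 < K + 1 := Nat.lt_floor_add_one _
  refine (arrivalLaw_compl_innerGapEvent_le_pow (by linarith) hη0 hη (K := K)
    (by linarith)).trans ?_
  rw [← ENNReal.ofReal_pow (by linarith)]
  refine ENNReal.ofReal_le_ofReal ?_
  calc (1 - η / 50) ^ K ≤ Real.exp (-(η / 50)) ^ K := by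
        gcongr
        · linarith
        · linarith [Real.add_one_le_exp (-(η / 50))]
    _ = Real.exp (K * -(η / 50)) := (Real.exp_nat_mul _ _).symm
    _ ≤ _ := Real.exp_le_exp.2 (by nlinarith)

lemma innerGapEvent_anti (L : ℝ) : Antitone (innerGapEvent L) := fun _ _ h _ ⟨u, v, hg, hr⟩ =>
  ⟨u, v, hg, h.trans hr⟩

theorem innerGapEvent_positive_probability {a : ℝ} (ha : 0 < a) :
    ∃ δ : ℝ, 0 < δ ∧ ∀ᶠ L : ℝ in atTop,
      ENNReal.ofReal δ ≤ arrivalLaw (innerGapEvent L (2 - a / L)) := by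
  refine ⟨1 - Real.exp (-(a / 1000)), ?_, ?_⟩
  · have : Real.exp (-(a / 1000)) < 1 := Real.exp_zero ▸ Real.exp_lt_exp.2 (by linarith)
    linarith
  filter_upwards [eventually_ge_atTop 24, eventually_ge_atTop a] with L hL hLa
  have hL0 : 0 < L := by linarith
  have h := arrivalLaw_compl_innerGapEvent_le hL (by positivity : 0 ≤ a / L)
    ((div_le_one hL0).2 hLa)
  rw [div_mul_cancel₀ _ hL0.ne'] at h
  have h1 := measure_union_le (μ := arrivalLaw) (innerGapEvent L (2 - a / L))
    (innerGapEvent L (2 - a / L))ᶜ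
  rw [union_compl_self, measure_univ] at h1
  rw [ENNReal.ofReal_sub _ (Real.exp_pos _).le, ENNReal.ofReal_one]
  exact tsub_le_iff_right.2 (h1.trans (by gcongr))

theorem withHighProbability_innerGapEvent {ε : ℝ} (hε : 0 < ε) :
    WithHighProbability fun L => innerGapEvent L (2 - 1 / L ^ (1 - ε)) := by
  refine withHighProbability_of_compl ?_
  have hlim : Tendsto (fun L : ℝ => min (1 / L ^ (1 - ε)) 1 * L / 1000) atTop atTop := by
    refine Tendsto.atTop_div_const (by norm_num) ?_
    have : Tendsto (fun L : ℝ => min (L ^ ε) L) atTop atTop :=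
      tendsto_atTop.2 fun b => by
        filter_upwards [(tendsto_rpow_atTop hε).eventually_ge_atTop b, eventually_ge_atTop b]
          with L h1 h2 using le_min h1 h2
    refine this.congr' ?_
    filter_upwards [eventually_gt_atTop 0] with L hL
    rw [min_mul_of_nonneg _ _ hL.le, one_mul, one_div, ← Real.rpow_neg hL.le]
    congr 1
    conv_rhs => rw [← Real.rpow_add_one hL.ne']
    congr 1; ring
  have hlim2 : Tendsto (fun L : ℝ =>
      ENNReal.ofReal (Real.exp (-(min (1 / L ^ (1 - ε)) 1 * L / 1000)))) atTop (𝓝 0) := by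
    have := ENNReal.tendsto_ofReal
      (Real.tendsto_exp_atBot.comp (tendsto_neg_atTop_atBot.comp hlim))
    simpa using this
  refine tendsto_of_tendsto_of_tendsto_of_le_of_le' tendsto_const_nhds hlim2
    (Eventually.of_forall fun _ => zero_le) ?_
  filter_upwards [eventually_ge_atTop 24] with L hL
  refine (measure_mono (compl_subset_compl.2 (innerGapEvent_anti L ?_))).trans
    (arrivalLaw_compl_innerGapEvent_le hL (by positivity) (min_le_right (1 / L ^ (1 - ε)) 1))
  linarith [min_le_left (1 / L ^ (1 - ε)) 1]

end Parking

theorem theorem1p2 :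
    (∀ η : ℝ → ℝ, η =o[atTop] (fun L : ℝ => 1 / L) →
      Parking.WithHighProbability fun L => (Parking.gapEvent L (2 - η L))ᶜ) ∧
    (∀ a : ℝ, 0 < a → ∃ δ : ℝ, 0 < δ ∧ ∀ᶠ L : ℝ in atTop,
      ENNReal.ofReal δ ≤ Parking.arrivalLaw (Parking.innerGapEvent L (2 - a / L))) ∧
    (∀ ε : ℝ, 0 < ε →
      Parking.WithHighProbability fun L => Parking.innerGapEvent L (2 - 1 / L ^ (1 - ε))) := by
  exact ⟨fun η hη => Parking.withHighProbability_no_large_gap hη,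
    fun a ha => Parking.innerGapEvent_positive_probability ha,
    fun ε hε => Parking.withHighProbability_innerGapEvent hε⟩
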